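/- Consider a single-resource loss network (stochastic knapsack) with capacity $b>0$ and classes $i=1,\dots,m$; class $i$ has Poisson arrival rate $\lambda_i>0$, exponential service rate $\mu_i>0$, load $\rho_i=\lambda_i/\mu_i$, capacity request $b_i>0$ and reward rate $r_i\ge 0$ per unit time, where at least one $r_i$ is positive. For $\kappa>0$ let $\mathrm{LP}(\kappa)$ be the linear program: maximize $\sum_i r_i\rho_i\alpha_i$ subject to $\sum_i b_i\rho_i\alpha_i\le\kappa$ and $0\le\alpha_i\le1$ for all $i$. Its dual is: minimize $u\kappa+\sum_i v_i$ subject to $v_i+b_i\rho_i u\ge r_i\rho_i$ and $v_i\ge0$ for all $i$, and $u\ge0$. Let $R^*$ be the optimal value of $\mathrm{LP}(b)$, let $(u^*,\mathbf v^*)$ be an optimal solution of the dual of $\mathrm{LP}(b)$, and let $$\varepsilon_0=\sup\{\varepsilon\ge0:\ (u^*,\mathbf v^*)\text{ is optimal for the dual of }\mathrm{LP}(b/(1+4\varepsilon))\}\in[0,\infty].$$ Let $0<\varepsilon<\min\{\varepsilon_0,\tfrac14\}$, let $\alpha^\varepsilon$ be an optimal solution of $\mathrm{LP}(b/(1+4\varepsilon))$,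 put $c_i^0=(1+4\varepsilon)\alpha_i^\varepsilon b_i\rho_i$ and $c_i^1=(1+4\varepsilon)(1-\alpha_i^\varepsilon)b_i\rho_i$, and let $\beta>0$ satisfy $$\beta\le\varepsilon\min\Big\{\min_{1\le i\le m}\frac{c_i^0}{b_i},\ \min_{i:\,\alpha_i^\varepsilon<1}\frac{c_i^1}{b_i}\Big\}$$ (a minimum over the empty set is $+\infty$). Let $\zeta=\big(\frac{\log 2}{\beta}+1-\frac\varepsilon2\big)(1+4\varepsilon)-1$ and, for $t\ge0$, $$L(t)=\max\Big\{\sum_{i=1}^m\alpha_i^\varepsilon r_i\rho_i(1-e^{-\mu_i t})-\zeta\sum_{i=1}^m(1-\alpha_i^\varepsilon)r_i\rho_i-2e^{-\varepsilon(\beta-4)/2}\sum_{i=1}^m r_i\rho_i(1-e^{-\mu_i t}),\ 0\Big\}.$$ Then $\bar L=\lim_{t\to\infty}L(t)$ exists and $$\frac{\bar L}{R^*}\ \ge\ 1-12\varepsilon-\frac{2\log 2}{\beta}-\Big(2e^{-\varepsilon(\beta-4)/2}+8\varepsilon+\frac{2\log 2}{\beta}\Big)\frac{\sum_{i=1}^m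 r_i\rho_i}{R^*}.$$ -/

import Mathlib

open Filter Topology

noncomputable section

/-- The single-resource loss network (stochastic knapsack): `m` Poisson arrival classes; class `i` has
arrival rate `lam i`, exponential service times of rate `mu i`, capacity request `req i` and reward
rate `r i` per unit time; all classes share one resource of capacity `b`. -/
structure Knapsack (m : ℕ) where
  lam : Fin m → ℝ
  mu : Fin m → ℝ
  req : Fin m → ℝ
  r : Fin m → ℝ
  b : ℝ
  lam_pos : ∀ i, 0 < lam i
  mu_pos : ∀ i, 0 < mu i
  req_pos : ∀ i, 0 < req i
  r_nonneg : ∀ i, 0 ≤ r i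
  b_pos : 0 < b

namespace Knapsack

variable {m : ℕ} (K : Knapsack m)

/-- The load `ρ i = λ i / μ i` of class `i`. -/
def rho (i : Fin m) : ℝ := K.lam i / K.mu i

/-- The objective `∑ i, r i * ρ i * α i` of the linear programs. -/
def reward (α : Fin m → ℝ) : ℝ := ∑ i, K.r i * K.rho i * α i

/-- The feasible region of the linear program with capacity `κ`:
`∑ i, b i * ρ i * α i ≤ κ` and `0 ≤ α i ≤ 1`. -/
def feasible (κ : ℝ) : Set (Fin m → ℝ) :=
  {α | ∑ i, K.req i * K.rho i * α i ≤ κ ∧ ∀ i, 0 ≤ α i ∧ α i ≤ 1}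

/-- `α` is an optimal solution of the linear program with capacity `κ`. -/
def IsOptimal (κ : ℝ) (α : Fin m → ℝ) : Prop :=
  α ∈ K.feasible κ ∧ ∀ α' ∈ K.feasible κ, K.reward α' ≤ K.reward α

/-- `R*`, the optimal value of the steady-state linear program, which has capacity `b`. The set is
nonempty and bounded. -/
def Rstar : ℝ := sSup (K.reward '' K.feasible K.b)

/-- The capacity `b / (1 + 4 ε)` of the `ε`-perturbed steady-state linear program. -/
def perturbedCapacity (ε : ℝ) : ℝ := K.b / (1 + 4 * ε)

/-- Feasibility of `(u, v)` for the dual linear program (the same for every capacity `κ`):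
`v i + b i * ρ i * u ≥ r i * ρ i`, `v ≥ 0`, `u ≥ 0`. -/
def DualFeasible (u : ℝ) (v : Fin m → ℝ) : Prop :=
  (∀ i, K.r i * K.rho i ≤ v i + K.req i * K.rho i * u) ∧ (∀ i, 0 ≤ v i) ∧ 0 ≤ u

/-- `(u, v)` minimizes `u * κ + ∑ i, v i` over the dual feasible region, that is, it is an optimal
solution of the dual of the linear program with capacity `κ`. -/
def IsDualOptimal (κ u : ℝ) (v : Fin m → ℝ) : Prop :=
  K.DualFeasible u v ∧
    ∀ (u' : ℝ) (v' : Fin m → ℝ), K.DualFeasible u' v' → u * κ + ∑ i, v i ≤ u' * κ + ∑ i, v' i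

/-- `ε₀`: the largest `ε ≥ 0` for which `(u, v)` is optimal for the dual of the `ε`-perturbed linear
program. It is a supremum in the extended reals, since `(u, v)` can be optimal for all `ε`
(then `ε₀ = ∞`, for instance when no `v i` is positive and `u > 0`). -/
def eps0 (u : ℝ) (v : Fin m → ℝ) : EReal :=
  sSup ((fun ε : ℝ => (ε : EReal)) '' {ε : ℝ | 0 ≤ ε ∧ K.IsDualOptimal (K.perturbedCapacity ε) u v})

/-- The target capacity of class `i` in system 0. -/
def c0 (ε : ℝ) (α : Fin m → ℝ) (i : Fin m) : ℝ := (1 + 4 * ε) * α i * K.req i * K.rho i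

/-- The target capacity of class `i` in the fictitious system 1. -/
def c1 (ε : ℝ) (α : Fin m → ℝ) (i : Fin m) : ℝ := (1 + 4 * ε) * (1 - α i) * K.req i * K.rho i

/-- The bound on the multiplier `β`:
`β ≤ ε * min (min over all i of c⁰ i / b i) (min over {i | α i < 1} of c¹ i / b i)`,
where a minimum over the empty set imposes no constraint. -/
def BetaBound (ε : ℝ) (α : Fin m → ℝ) (β : ℝ) : Prop :=
  (∀ i, β ≤ ε * (K.c0 ε α i / K.req i)) ∧ (∀ i, α i < 1 → β ≤ ε * (K.c1 ε α i / K.req i))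

/-- The constant `ζ`. -/
def zeta (ε β : ℝ) : ℝ := (Real.log 2 / β + 1 - ε / 2) * (1 + 4 * ε) - 1

/-- The lower bound `L(t)` on the expected reward rate of the penalty policy at time `t`. -/
def L (ε β : ℝ) (α : Fin m → ℝ) (t : ℝ) : ℝ :=
  max
    (∑ i, α i * K.r i * K.rho i * (1 - Real.exp (-K.mu i * t))
      - zeta ε β * ∑ i, (1 - α i) * K.r i * K.rho i
      - 2 * Real.exp (-(ε / 2) * (β - 4)) * ∑ i, K.r i * K.rho i * (1 - Real.exp (-K.mu i * t)))
    0

end Knapsack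

end

/-!
Multiplying every feasible `α` by `c ∈ [0, 1]` gives a feasible point for the capacity scaled by
`c`, so the value of the linear program at capacity `c * b` is at least `c * R*`. With
`c = (1 + 4 * ε)⁻¹`, the perturbed optimum keeps a fraction `(1 + 4 * ε)⁻¹ ≥ 1 - 4 * ε` of `R*`.
As `t → ∞` the exponentials `exp (-μ i * t)` in `L` vanish, and `ζ ≤ 8 * ε + 2 * log 2 / β` bounds
the loss from system 1.
-/

namespace Knapsack

variable {m : ℕ} (K : Knapsack m)

theorem rho_pos (i : Fin m) : 0 < K.rho i :=
  div_pos (K.lam_pos i) (K.mu_pos i)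

theorem r_mul_rho_nonneg (i : Fin m) : 0 ≤ K.r i * K.rho i :=
  mul_nonneg (K.r_nonneg i) (K.rho_pos i).le

theorem reward_one : K.reward 1 = ∑ i, K.r i * K.rho i := by
  simp only [reward, Pi.one_apply, mul_one]

theorem reward_smul (c : ℝ) (α : Fin m → ℝ) : K.reward (c • α) = c * K.reward α := by
  simp only [reward, Pi.smul_apply, smul_eq_mul, Finset.mul_sum, mul_left_comm]

theorem monotone_reward : Monotone K.reward := fun _ _ h =>
  Finset.sum_le_sum fun i _ =>
    mul_le_mul_of_nonneg_left (h i) (K.r_mul_rho_nonneg i)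

theorem reward_nonneg {α : Fin m → ℝ} (hα : 0 ≤ α) : 0 ≤ K.reward α := by
  simpa [reward] using K.monotone_reward hα

theorem continuous_reward : Continuous K.reward := by
  unfold reward
  fun_prop

theorem reward_one_pos (hr : ∃ i, 0 < K.r i) : 0 < K.reward 1 := by
  obtain ⟨j, hj⟩ := hr
  rw [reward_one]
  exact Finset.sum_pos' (fun i _ => K.r_mul_rho_nonneg i)
    ⟨j, Finset.mem_univ j, mul_pos hj (K.rho_pos j)⟩

theorem feasible_subset_Icc (κ : ℝ) : K.feasible κ ⊆ Set.Icc 0 1 := fun _ hα =>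
  ⟨fun i => (hα.2 i).1, fun i => (hα.2 i).2⟩

theorem zero_mem_feasible {κ : ℝ} (hκ : 0 ≤ κ) : 0 ∈ K.feasible κ :=
  ⟨by simpa using hκ, fun _ => by simp⟩

theorem smul_mem_feasible {κ c : ℝ} (hc₀ : 0 ≤ c) (hc₁ : c ≤ 1) {α : Fin m → ℝ}
    (hα : α ∈ K.feasible κ) : c • α ∈ K.feasible (c * κ) := by
  refine ⟨?_, fun i => ⟨mul_nonneg hc₀ (hα.2 i).1, mul_le_one₀ hc₁ (hα.2 i).1 (hα.2 i).2⟩⟩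
  simpa only [Pi.smul_apply, smul_eq_mul, Finset.mul_sum, mul_left_comm]
    using mul_le_mul_of_nonneg_left hα.1 hc₀

theorem isLUB_Rstar : IsLUB (K.reward '' K.feasible K.b) K.Rstar := by
  refine isLUB_csSup ⟨_, 0, K.zero_mem_feasible K.b_pos.le, rfl⟩ ⟨K.reward 1, ?_⟩
  rintro _ ⟨α, hα, rfl⟩
  exact K.monotone_reward (K.feasible_subset_Icc _ hα).2

theorem Rstar_nonneg : 0 ≤ K.Rstar :=
  (K.reward_nonneg le_rfl).trans <| K.isLUB_Rstar.1 ⟨0, K.zero_mem_feasible K.b_pos.le, rfl⟩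

theorem Rstar_pos (hr : ∃ i, 0 < K.r i) : 0 < K.Rstar := by
  set T := ∑ i, K.req i * K.rho i
  have hT : 0 ≤ T := Finset.sum_nonneg fun i _ => (mul_pos (K.req_pos i) (K.rho_pos i)).le
  have hbT : 0 < K.b + T := add_pos_of_pos_of_nonneg K.b_pos hT
  have hone : 1 ∈ K.feasible (K.b + T) := ⟨by simp [T, K.b_pos.le], fun _ => by simp⟩
  have hmem : (K.b / (K.b + T)) • 1 ∈ K.feasible K.b := by
    simpa only [div_mul_cancel₀ _ hbT.ne'] using
      K.smul_mem_feasible (div_nonneg K.b_pos.le hbT.le)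
        (div_le_one_of_le₀ (le_add_of_nonneg_right hT) hbT.le) hone
  calc 0 < K.b / (K.b + T) * K.reward 1 := mul_pos (div_pos K.b_pos hbT) (K.reward_one_pos hr)
    _ = K.reward ((K.b / (K.b + T)) • 1) := (K.reward_smul _ _).symm
    _ ≤ K.Rstar := K.isLUB_Rstar.1 ⟨_, hmem, rfl⟩

variable {K} in
theorem IsOptimal.mul_Rstar_le {c : ℝ} (hc₀ : 0 ≤ c) (hc₁ : c ≤ 1) {α : Fin m → ℝ}
    (hα : K.IsOptimal (c * K.b) α) : c * K.Rstar ≤ K.reward α := by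
  refine (K.isLUB_Rstar.mul_left hc₀).2 ?_
  rintro _ ⟨_, ⟨α', hα', rfl⟩, rfl⟩
  simpa only [reward_smul] using hα.2 _ (K.smul_mem_feasible hc₀ hc₁ hα')

variable {K} in
theorem IsOptimal.one_sub_mul_Rstar_le {ε : ℝ} (hε : 0 ≤ ε) {α : Fin m → ℝ}
    (hα : K.IsOptimal (K.perturbedCapacity ε) α) :
    (1 - 4 * ε) * K.Rstar ≤ K.reward α := by
  have hpos : 0 < 1 + 4 * ε := by positivity
  have hinv : 1 - 4 * ε ≤ (1 + 4 * ε)⁻¹ := by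
    rw [← one_div, le_div_iff₀ hpos]
    nlinarith [sq_nonneg ε]
  rw [perturbedCapacity, div_eq_inv_mul] at hα
  exact (mul_le_mul_of_nonneg_right hinv K.Rstar_nonneg).trans <|
    hα.mul_Rstar_le (inv_nonneg.2 hpos.le) (inv_le_one_of_one_le₀ (by linarith))

/-- The profile `1 - exp (-μ i * t)`: the expected number of class-`i` customers present at time
`t`, as a fraction of the load `ρ i`, in an infinite-server system that starts empty. -/
noncomputable def transient (t : ℝ) (i : Fin m) : ℝ := 1 - Real.exp (-K.mu i * t)

theorem tendsto_transient : Tendsto K.transient atTop (𝓝 1) := by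
  refine tendsto_pi_nhds.2 fun i => ?_
  have h : Tendsto (fun t => -K.mu i * t) atTop atBot :=
    tendsto_id.const_mul_atTop_of_neg (neg_lt_zero.2 (K.mu_pos i))
  simpa only [transient, Function.comp_def, sub_zero, Pi.one_apply]
    using (Real.tendsto_exp_atBot.comp h).const_sub 1

theorem L_eq_reward (ε β : ℝ) (α : Fin m → ℝ) (t : ℝ) :
    K.L ε β α t = max (K.reward (α * K.transient t) - zeta ε β * K.reward (1 - α)
      - 2 * Real.exp (-(ε / 2) * (β - 4)) * K.reward (K.transient t)) 0 := by
  simp only [L, reward, transient, Pi.mul_apply, Pi.sub_apply, Pi.one_apply, mul_assoc,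
    mul_left_comm (K.r _), mul_left_comm (K.rho _), mul_comm (K.rho _)]

theorem tendsto_L (ε β : ℝ) (α : Fin m → ℝ) :
    Tendsto (K.L ε β α) atTop
      (𝓝 (max (K.reward α - zeta ε β * K.reward (1 - α)
        - 2 * Real.exp (-(ε / 2) * (β - 4)) * K.reward 1) 0)) := by
  have hadmitted : Tendsto (fun t => K.reward (α * K.transient t)) atTop (𝓝 (K.reward α)) := by
    simpa only [mul_one, Function.comp_def] using
      (K.continuous_reward.tendsto _).comp (K.tendsto_transient.const_mul α)
  have htotal : Tendsto (fun t => K.reward (K.transient t)) atTop (𝓝 (K.reward 1)) :=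
    (K.continuous_reward.tendsto _).comp K.tendsto_transient
  simp only [funext (K.L_eq_reward ε β α)]
  exact ((hadmitted.sub_const _).sub (htotal.const_mul _)).max tendsto_const_nhds

theorem zeta_le {ε β : ℝ} (hε₀ : 0 ≤ ε) (hε₁ : ε ≤ 1 / 4) (hβ : 0 < β) :
    zeta ε β ≤ 8 * ε + 2 * Real.log 2 / β := by
  have hlog : 0 ≤ Real.log 2 / β := by positivity
  calc zeta ε β = 7 / 2 * ε - 2 * ε ^ 2 + (1 + 4 * ε) * (Real.log 2 / β) := by
        unfold zeta
        ring
    _ ≤ 8 * ε + 2 * (Real.log 2 / β) :=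
        add_le_add (by linarith [sq_nonneg ε])
          (mul_le_mul_of_nonneg_right (by linarith) hlog)
    _ = 8 * ε + 2 * Real.log 2 / β := by rw [mul_div_assoc]

theorem zeta_mul_reward_one_sub_le {ε β : ℝ} (hε₀ : 0 ≤ ε) (hε₁ : ε ≤ 1 / 4) (hβ : 0 < β)
    {α : Fin m → ℝ} (hα : α ∈ Set.Icc 0 1) :
    zeta ε β * K.reward (1 - α) ≤ (8 * ε + 2 * Real.log 2 / β) * K.reward 1 :=
  mul_le_mul (zeta_le hε₀ hε₁ hβ) (K.monotone_reward (sub_le_self 1 hα.1))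
    (K.reward_nonneg (sub_nonneg.2 hα.2)) (by positivity)

end Knapsack

theorem corollary1_general {m : ℕ} (K : Knapsack m) (hr : ∃ i, 0 < K.r i)
    (ε : ℝ) (hε₀ : 0 ≤ ε) (hε₁ : ε ≤ 1 / 4)
    (α : Fin m → ℝ) (hα : K.IsOptimal (K.perturbedCapacity ε) α) (β : ℝ) (hβ : 0 < β) :
    ∃ Lbar : ℝ, Tendsto (K.L ε β α) atTop (𝓝 Lbar) ∧
      Lbar / K.Rstar ≥
        1 - 12 * ε - 2 * Real.log 2 / β
          - (2 * Real.exp (-(ε / 2) * (β - 4)) + 8 * ε + 2 * Real.log 2 / β)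
            * ((∑ i, K.r i * K.rho i) / K.Rstar) := by
  refine ⟨_, K.tendsto_L ε β α, ?_⟩
  have hR := K.Rstar_pos hr
  have hgain : (1 - 12 * ε - 2 * Real.log 2 / β) * K.Rstar ≤ K.reward α := by
    have hlog : 0 ≤ 2 * Real.log 2 / β := by positivity
    exact (mul_le_mul_of_nonneg_right (by linarith) hR.le).trans
      (hα.one_sub_mul_Rstar_le hε₀)
  have hloss := K.zeta_mul_reward_one_sub_le hε₀ hε₁ hβ (K.feasible_subset_Icc _ hα.1)
  rw [← K.reward_one, ge_iff_le, le_div_iff₀ hR, sub_mul, mul_assoc _ (_ / _),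
    div_mul_cancel₀ _ hR.ne']
  exact le_max_of_le_left (by linarith)

theorem corollary1 {m : ℕ} (K : Knapsack m) (hr : ∃ i, 0 < K.r i)
    (ustar : ℝ) (vstar : Fin m → ℝ) (hdual : K.IsDualOptimal K.b ustar vstar)
    (ε : ℝ) (hε_pos : 0 < ε) (hε : (ε : EReal) < min (K.eps0 ustar vstar) ((1 / 4 : ℝ) : EReal))
    (α : Fin m → ℝ) (hα : K.IsOptimal (K.perturbedCapacity ε) α)
    (β : ℝ) (hβ_pos : 0 < β) (hβ : K.BetaBound ε α β) :
    ∃ Lbar : ℝ, Tendsto (K.L ε β α) atTop (𝓝 Lbar) ∧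
      Lbar / K.Rstar ≥
        1 - 12 * ε - 2 * Real.log 2 / β
          - (2 * Real.exp (-(ε / 2) * (β - 4)) + 8 * ε + 2 * Real.log 2 / β)
            * ((∑ i, K.r i * K.rho i) / K.Rstar) :=
  corollary1_general K hr ε hε_pos.le (EReal.coe_lt_coe_iff.1 (lt_min_iff.1 hε).2).le α hα β hβ_pos
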